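/- All graphs are finite, undirected and simple. For a graph $G$ let $\gamma(G)$ be the size of a minimum dominating set of $G$, and let $\nabla_0(G)$, $\nabla_1(G)$, $\nabla_1^B(G)$ be the maximum of $|E(H)|/|V(H)|$ over all non-empty subgraphs $H$ of $G$, over all non-empty $1$-shallow minors $H$ of $G$, and over all non-empty bipartite $1$-shallow minors $H$ of $G$, respectively (and $0$ if $G$ has no vertices). Here $H$ is a $1$-shallow minor of $G$ if there are pairwise vertex disjoint connected subgraphs $G_v\subseteq G$ ($v\in V(H)$), each of radius at most $1$, such that for every edge $uv$ of $H$ some edge of $G$ joins $G_u$ to $G_v$. A LOCAL algorithm is a deterministic synchronous message-passing algorithm on the network $G$, with pairwise distinct natural numbers as node identifiers, an arbitrary port numbering, and no restriction on message size or local computation; initially a node knows only its own identifier. Let $\nabla_1>0$ be an integer and put $c=2(\nabla_1+1)$. (1) There are an integer $r$ and a LOCAL algorithm that, on every graph $G$ with $\nabla_1(G)\le\nabla_1$, computes in $r$ rounds a dominating set of $G$ of size at most $(c^{2c^2}+c)\,\gamma(G)$; in particular it computes, in a number of rounds that depends only on $\nabla_1$, a dominating set of size $\mathcal O(\gamma(G))$,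 with a constant depending only on $\nabla_1$. (2) For every integer $t$ there is an integer $r$ (depending only on $\nabla_1$ and $t$) such that the following holds. Let $\nabla_0,\nabla,s$ be non-negative integers with $\nabla_0\le\nabla_1$, $\nabla\le\nabla_1+1$ and $1\le s\le t$, and put $\kappa=\max\{2\nabla_0,2\nabla\}$. There is a LOCAL algorithm that, on every graph $G$ with $\nabla_1(G)\le\nabla_1$, $\nabla_0(G)\le\nabla_0$, $\nabla_1^B(G)<\nabla$ and with no subgraph isomorphic to $K_{s,t}$, computes in $r$ rounds a dominating set of $G$ of size at most $$2(\nabla_0+1)\bigl(\kappa^{2s\kappa}+2\bigr)\,\gamma(G).$$ (3) For all non-negative integers $\nabla_0\le\nabla_1$, $\nabla\le\nabla_1+1$ and $s\le 2\nabla_1+1$, with $\kappa=\max\{2\nabla_0,2\nabla\}$, we have $2(\nabla_0+1)(\kappa^{2s\kappa}+2)\le c^{2c^2}+c$. -/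

import Mathlib

/-! ### Dominating sets -/

namespace SimpleGraph

/-- `D` is a dominating set of `G`: every vertex lies in the closed neighbourhood of `D`. -/
def IsDominatingSet {V : Type*} (G : SimpleGraph V) (D : Set V) : Prop :=
  ∀ v, ∃ u ∈ D, u = v ∨ G.Adj u v

/-- The domination number `γ(G)`: the least size of a dominating set of the finite graph `G`. -/
noncomputable def dominationNumber {V : Type*} [Finite V] (G : SimpleGraph V) : ℕ :=
  sInf {k | ∃ D : Set V, G.IsDominatingSet D ∧ D.ncard = k}

/-! ### Shallow minors and edge densities -/

/-- A minor model of `H` in `G`: vertex disjoint connected subgraphs of `G`, one for each vertex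
of `H`, such that adjacent vertices of `H` have branch sets joined by an edge of `G`. -/
structure MinorModel {W V : Type*} (H : SimpleGraph W) (G : SimpleGraph V) where
  branch : W → G.Subgraph
  connected : ∀ w, (branch w).Connected
  disjoint : ∀ u w, u ≠ w → Disjoint (branch u).verts (branch w).verts
  adj : ∀ u w, H.Adj u w → ∃ x ∈ (branch u).verts, ∃ y ∈ (branch w).verts, G.Adj x y

/-- `H` is an `r`-shallow minor of `G`: some minor model has all its branch sets of radius at
most `r`. -/
def IsShallowMinor {W V : Type*} (r : ℕ) (H : SimpleGraph W) (G : SimpleGraph V) : Prop :=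
  ∃ M : MinorModel H G, ∀ w, (M.branch w).coe.radius ≤ r

/-- The edge densities `|E(H)| / |V(H)|` of the non-empty subgraphs `H` of `G`. -/
def subgraphDensities {V : Type*} (G : SimpleGraph V) : Set ℝ :=
  {q | ∃ H : G.Subgraph, H.verts.Nonempty ∧
    q = (H.edgeSet.ncard : ℝ) / (H.verts.ncard : ℝ)}

/-- The edge densities `|E(H)| / |V(H)|` of the non-empty `1`-shallow minors `H` of `G`. -/
def minorDensities {V : Type*} (G : SimpleGraph V) : Set ℝ :=
  {q | ∃ n : ℕ, 0 < n ∧ ∃ H : SimpleGraph (Fin n), IsShallowMinor 1 H G ∧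
    q = (H.edgeSet.ncard : ℝ) / (n : ℝ)}

/-- The edge densities `|E(H)| / |V(H)|` of the non-empty bipartite `1`-shallow minors of `G`. -/
def bipartiteMinorDensities {V : Type*} (G : SimpleGraph V) : Set ℝ :=
  {q | ∃ n : ℕ, 0 < n ∧ ∃ H : SimpleGraph (Fin n), IsShallowMinor 1 H G ∧ H.IsBipartite ∧
    q = (H.edgeSet.ncard : ℝ) / (n : ℝ)}

/-- `∇₀(G)`, the largest edge density of a subgraph of `G`. -/
noncomputable def nabla0 {V : Type*} [Finite V] (G : SimpleGraph V) : ℝ :=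
  sSup G.subgraphDensities

/-- `∇₁(G)`, the largest edge density of a `1`-shallow minor of `G`. -/
noncomputable def nabla1 {V : Type*} [Finite V] (G : SimpleGraph V) : ℝ :=
  sSup G.minorDensities

/-- `∇₁ᴮ(G)`, the largest edge density of a bipartite `1`-shallow minor of `G`. -/
noncomputable def nabla1B {V : Type*} [Finite V] (G : SimpleGraph V) : ℝ :=
  sSup G.bipartiteMinorDensities

/-! The three suprema are maxima of finite sets (non-empty ones, if the graph has a vertex). -/

theorem finite_subgraphDensities {V : Type*} [Finite V] (G : SimpleGraph V) :
    G.subgraphDensities.Finite := by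
  refine (Set.finite_range fun H : G.Subgraph =>
    (H.edgeSet.ncard : ℝ) / (H.verts.ncard : ℝ)).subset ?_
  rintro q ⟨H, -, rfl⟩
  exact ⟨H, rfl⟩

theorem MinorModel.card_le {V : Type*} [Finite V] {G : SimpleGraph V} {n : ℕ}
    {H : SimpleGraph (Fin n)} (M : MinorModel H G) : n ≤ Nat.card V := by
  choose c hc using fun w => (M.connected w).nonempty
  have hinj : Function.Injective c := by
    intro u w huw
    by_contra hne
    exact Set.disjoint_left.mp (M.disjoint u w hne) (hc u) (huw ▸ hc w)
  simpa using Nat.card_le_card_of_injective c hinj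

theorem finite_minorDensities {V : Type*} [Finite V] (G : SimpleGraph V) :
    G.minorDensities.Finite := by
  refine (Set.finite_range fun p : (n : Fin (Nat.card V + 1)) × SimpleGraph (Fin n) =>
    (p.2.edgeSet.ncard : ℝ) / ((p.1 : ℕ) : ℝ)).subset ?_
  rintro q ⟨n, -, H, ⟨M, -⟩, rfl⟩
  exact ⟨⟨⟨n, Nat.lt_succ_of_le M.card_le⟩, H⟩, rfl⟩

theorem finite_bipartiteMinorDensities {V : Type*} [Finite V] (G : SimpleGraph V) :
    G.bipartiteMinorDensities.Finite := by
  refine G.finite_minorDensities.subset ?_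
  rintro q ⟨n, hn, H, hM, -, rfl⟩
  exact ⟨n, hn, H, hM, rfl⟩

end SimpleGraph

/-! ### The LOCAL model -/

/-- A port numbering of `G`: every vertex `v` numbers its neighbours by `0, …, deg v - 1`. -/
structure PortNumbering {V : Type*} (G : SimpleGraph V) where
  deg : V → ℕ
  port : ∀ v, Fin (deg v) ≃ G.neighborSet v

/-- A deterministic message-passing algorithm in the LOCAL model. Every node runs the same
program; neither message size nor local computation is restricted. At the start a node knows
only its own identifier. In each round it sends one message through each of its ports and then
updates its state from the list of received messages, ordered by its ports. -/
structure LocalAlgorithm (Out : Type) where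
  State : Type
  Msg : Type
  init : ℕ → State
  send : State → ℕ → Msg
  receive : State → List Msg → State
  output : State → Out

namespace LocalAlgorithm

/-- The messages that arrive at `v`, ordered by the ports of `v`, if `σ` gives the states of the
nodes at the start of the round: the neighbour `u` at a port of `v` sends the message that
it has for that port of `u` which leads to `v`. -/
def inbox {Out : Type} (A : LocalAlgorithm Out) {V : Type*} {G : SimpleGraph V}
    (P : PortNumbering G) (σ : V → A.State) (v : V) : List A.Msg :=
  List.ofFn fun i : Fin (P.deg v) =>
    A.send (σ (P.port v i)) ((P.port (P.port v i)).symm ⟨v, (P.port v i).2.symm⟩)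

/-- The states of the nodes after the given number of synchronous rounds on the network `G` with
identifiers `ident`. -/
def stateAfter {Out : Type} (A : LocalAlgorithm Out) {V : Type*} {G : SimpleGraph V}
    (P : PortNumbering G) (ident : V → ℕ) : ℕ → V → A.State
  | 0 => fun v => A.init (ident v)
  | r + 1 => fun v =>
      A.receive (A.stateAfter P ident r v) (A.inbox P (A.stateAfter P ident r) v)

/-- The set of nodes that are selected by (output `true` in) `r` rounds of the algorithm. -/
def selected (A : LocalAlgorithm Bool) {V : Type*} {G : SimpleGraph V}
    (P : PortNumbering G) (ident : V → ℕ) (r : ℕ) : Set V :=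
  {v | A.output (A.stateAfter P ident r v) = true}

/-- On the network `G`, whatever the port numbering and the (distinct) identifiers are, the
algorithm selects in `r` rounds a dominating set of size at most `C * γ(G)`. -/
def ApproximatesDominatingSet (A : LocalAlgorithm Bool) (r C : ℕ) {V : Type*} [Finite V]
    (G : SimpleGraph V) : Prop :=
  ∀ (P : PortNumbering G) (ident : V → ℕ), Function.Injective ident →
    G.IsDominatingSet (A.selected P ident r) ∧
      (A.selected P ident r).ncard ≤ C * G.dominationNumber

end LocalAlgorithm

/-- The parameter `κ = max {2∇₀, 2∇}`. -/
def kappa (d₀ b : ℕ) : ℕ := max (2 * d₀) (2 * b)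

/-- The approximation factor `2(∇₀ + 1)(κ^(2sκ) + 2)`. -/
def approxFactor (d₀ b s : ℕ) : ℕ :=
  2 * (d₀ + 1) * (kappa d₀ b ^ (2 * s * kappa d₀ b) + 2)

/-! Fix b > ∇₁ᴮ(G), put k = 2b, and let D be a minimum dominating set. The algorithm first selects
the rich core. This is cheap (`ncard_richCore_le`). If a minimal rich set misses D, then fewer than
k vertices of D never dominate the neighbourhood of one of its vertices. Contracting stars around D
turns an independent set I of such vertices into one side of a bipartite 1-shallow minor in which
all of I has degree at least 2b; density below b then forces |I| ≤ |D|, and bounded ∇₀ makes I a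
constant fraction of all such vertices. If a small minimal rich set meets D, branching from a common
vertex leaves at most k^(s-1) vertices per element of D.

Let R be the set of vertices that the core does not dominate. Every vertex has boundedly many
neighbours in R (`card_lt_residualBound`): a set of fewer than s vertices with a common neighbour in
R is not rich, so few vertices dominate its common neighbours in R and one of them is adjacent to
many; iterating would build K_{s,t}. This degree bound makes a primal-dual doubling process on R
finish in boundedly many rounds, while its loss depends only on ∇₀ (`card_primalDual_le`).

Richness concerns only a bounded neighbourhood (`mem_richCore_iff_of_local`), so each phase is a
composition of exchanges between neighbours, and `NodeMap.LocallyComputable.step` counts the rounds.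
If only ∇₁ ≤ d is known, b = d + 1 is admissible and some K_{d+1,t} is too dense to occur. -/

/-! ### Functions that are computable in the LOCAL model -/

/-- A value at every node of every network. -/
def NodeMap.{u} (α : Type) : Type (u + 1) :=
  ∀ (V : Type u) (G : SimpleGraph V), PortNumbering G → (V → ℕ) → V → α

/-- Some LOCAL algorithm outputs the values of `f` after `r` rounds. -/
def NodeMap.LocallyComputable.{u} {α : Type} (f : NodeMap.{u} α) (r : ℕ) : Prop :=
  ∃ A : LocalAlgorithm α, ∀ (V : Type u) (G : SimpleGraph V) (P : PortNumbering G)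
    (ident : V → ℕ) (v : V), A.output (A.stateAfter P ident r v) = f V G P ident v

/-- One round of communication: every node combines its value with those of its neighbours. -/
def NodeMap.step.{u} {α β : Type} (f : NodeMap.{u} α) (h : α → List α → β) : NodeMap.{u} β :=
  fun V G P ident v => h (f V G P ident v)
    (List.ofFn fun i : Fin (P.deg v) => f V G P ident (P.port v i))

/-- Run `A`, send its output along with every message, and combine the outputs of the node and of
its neighbours at the start of the last round. -/
def LocalAlgorithm.exchange {α β : Type} (A : LocalAlgorithm α) (h : α → List α → β) :
    LocalAlgorithm β where
  State := A.State × α × List α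
  Msg := A.Msg × α
  init n := (A.init n, A.output (A.init n), [])
  send σ i := (A.send σ.1 i, A.output σ.1)
  receive σ l := (A.receive σ.1 (l.map Prod.fst), A.output σ.1, l.map Prod.snd)
  output σ := h σ.2.1 σ.2.2

theorem LocalAlgorithm.exchange_stateAfter_fst {α β : Type} (A : LocalAlgorithm α)
    (h : α → List α → β) {V : Type*} {G : SimpleGraph V} (P : PortNumbering G) (ident : V → ℕ)
    (r : ℕ) (v : V) :
    ((A.exchange h).stateAfter P ident r v).1 = A.stateAfter P ident r v := by
  induction r generalizing v with
  | zero => rfl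
  | succ r ih =>
    change A.receive ((A.exchange h).stateAfter P ident r v).1
      (((A.exchange h).inbox P ((A.exchange h).stateAfter P ident r) v).map Prod.fst) = _
    rw [ih]
    refine congrArg _ ((List.map_ofFn (α := A.Msg × α)).trans
      (congrArg List.ofFn (funext fun i => ?_)))
    change A.send ((A.exchange h).stateAfter P ident r _).1 _ = _
    rw [ih]

/-- The only tool needed to prove locality: a function assembled from `step` costs one round per
use, so no message-passing program has to be written by hand. -/
theorem NodeMap.LocallyComputable.step.{u} {α β : Type} {f : NodeMap.{u} α} {r : ℕ}
    (hf : f.LocallyComputable r) (h : α → List α → β) :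
    (f.step h).LocallyComputable (r + 1) := by
  obtain ⟨A, hA⟩ := hf
  refine ⟨A.exchange h, fun V G P ident v => ?_⟩
  change h (A.output ((A.exchange h).stateAfter P ident r v).1)
    (((A.exchange h).inbox P ((A.exchange h).stateAfter P ident r) v).map Prod.snd) = _
  rw [A.exchange_stateAfter_fst, hA]
  refine congrArg _ ((List.map_ofFn (α := A.Msg × α)).trans
    (congrArg List.ofFn (funext fun i => ?_)))
  change A.output ((A.exchange h).stateAfter P ident r _).1 = _
  rw [A.exchange_stateAfter_fst, hA]

theorem NodeMap.LocallyComputable.mono.{u} {α : Type} {f : NodeMap.{u} α} {r r' : ℕ}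
    (hf : f.LocallyComputable r) (hr : r ≤ r') : f.LocallyComputable r' := by
  induction hr with
  | refl => exact hf
  -- An idle round: the received values are discarded.
  | step _ ih => exact ih.step fun a _ => a

/-- Every node knows its identifier. -/
def NodeMap.identifier.{u} : NodeMap.{u} ℕ := fun _ _ _ ident => ident

theorem NodeMap.locallyComputable_identifier.{u} :
    NodeMap.identifier.{u}.LocallyComputable 0 :=
  ⟨⟨ℕ, Unit, id, fun _ _ => (), fun n _ => n, id⟩, fun _ _ _ _ _ => rfl⟩

theorem PortNumbering.mem_ofFn_port {α V : Type*} {G : SimpleGraph V} (P : PortNumbering G)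
    (x : V → α) (v : V) (a : α) :
    a ∈ List.ofFn (fun i : Fin (P.deg v) => x (P.port v i)) ↔ ∃ u, G.Adj v u ∧ x u = a := by
  rw [List.mem_ofFn]
  constructor
  · rintro ⟨i, rfl⟩
    exact ⟨_, (P.port v i).2, rfl⟩
  · rintro ⟨u, hu, rfl⟩
    exact ⟨(P.port v).symm ⟨u, hu⟩, by simp⟩

theorem PortNumbering.sum_ofFn_port {V : Type*} [Fintype V] {G : SimpleGraph V}
    [DecidableRel G.Adj] (P : PortNumbering G) (x : V → ℕ) (v : V) :
    (List.ofFn fun i : Fin (P.deg v) => x (P.port v i)).sum = ∑ u with G.Adj v u, x u := by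
  rw [List.sum_ofFn, Equiv.sum_comp (P.port v) fun u => x u]
  exact (Finset.sum_subtype _ (by simp) x).symm

/-! ### Edge densities and shallow minors -/

namespace SimpleGraph

/-- The star with centre `c` whose leaves are the neighbours of `c` in `S`. -/
def starSubgraph {V : Type*} (G : SimpleGraph V) (c : V) (S : Set V) : G.Subgraph where
  verts := {v | v = c ∨ v ∈ S ∧ G.Adj c v}
  Adj x y := G.Adj x y ∧ (x = c ∧ y ∈ S ∨ y = c ∧ x ∈ S)
  adj_sub h := h.1
  edge_vert := by
    rintro x y ⟨h, ⟨rfl, -⟩ | ⟨rfl, hx⟩⟩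
    · exact Or.inl rfl
    · exact Or.inr ⟨hx, h.symm⟩
  symm := ⟨fun _ _ h => ⟨h.1.symm, h.2.symm⟩⟩

theorem starSubgraph_adj_center {V : Type*} (G : SimpleGraph V) (c : V) (S : Set V)
    (v : (G.starSubgraph c S).verts) (hv : v.1 ≠ c) :
    (G.starSubgraph c S).coe.Adj ⟨c, Or.inl rfl⟩ v := by
  obtain ⟨v, rfl | ⟨hS, hc⟩⟩ := v
  · exact absurd rfl hv
  · exact ⟨hc, Or.inl ⟨rfl, hS⟩⟩

theorem connected_starSubgraph {V : Type*} (G : SimpleGraph V) (c : V) (S : Set V) :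
    (G.starSubgraph c S).Connected := by
  rw [Subgraph.connected_iff']
  have : Nonempty (G.starSubgraph c S).verts := ⟨⟨c, Or.inl rfl⟩⟩
  have key : ∀ v, (G.starSubgraph c S).coe.Reachable ⟨c, Or.inl rfl⟩ v := by
    intro v
    by_cases hv : v.1 = c
    · have : v = ⟨c, Or.inl rfl⟩ := Subtype.ext hv
      rw [this]
    · exact (G.starSubgraph_adj_center c S v hv).reachable
  exact ⟨fun u v => (key u).symm.trans (key v)⟩

theorem radius_starSubgraph_le {V : Type*} (G : SimpleGraph V) (c : V) (S : Set V) :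
    (G.starSubgraph c S).coe.radius ≤ 1 := by
  refine radius_le_eccent.trans ((eccent_le_one_iff ⟨c, Or.inl rfl⟩).mpr fun v hv => ?_)
  exact G.starSubgraph_adj_center c S v fun h => hv (Subtype.ext h.symm)

/-- Stars have radius at most 1 and suffice as branch sets everywhere below; a star without leaves
is a single vertex. -/
theorem isShallowMinor_of_stars {W V : Type*} {H : SimpleGraph W} {G : SimpleGraph V}
    (c : W → V) (S : W → Set V)
    (hdisj : ∀ u w, u ≠ w →
      Disjoint (G.starSubgraph (c u) (S u)).verts (G.starSubgraph (c w) (S w)).verts)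
    (hadj : ∀ u w, H.Adj u w → ∃ x ∈ (G.starSubgraph (c u) (S u)).verts,
      ∃ y ∈ (G.starSubgraph (c w) (S w)).verts, G.Adj x y) :
    IsShallowMinor 1 H G :=
  ⟨⟨fun w => G.starSubgraph (c w) (S w), fun _ => connected_starSubgraph _ _ _, hdisj, hadj⟩,
    fun _ => radius_starSubgraph_le _ _ _⟩

theorem IsShallowMinor.of_iso {W W' V : Type*} {H : SimpleGraph W} {H' : SimpleGraph W'}
    {G : SimpleGraph V} {r : ℕ} (e : H' ≃g H) (h : IsShallowMinor r H G) :
    IsShallowMinor r H' G := by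
  obtain ⟨M, hM⟩ := h
  exact ⟨⟨fun w => M.branch (e w), fun w => M.connected _,
    fun u w huw => M.disjoint _ _ (e.injective.ne huw),
    fun u w huw => M.adj _ _ (e.map_adj_iff.mpr huw)⟩, fun w => hM _⟩

theorem exists_iso_fin {W : Type*} [Fintype W] (H : SimpleGraph W) :
    ∃ H' : SimpleGraph (Fin (Fintype.card W)), Nonempty (H' ≃g H) ∧
      H'.edgeSet.ncard = H.edgeSet.ncard := by
  let e : Fin (Fintype.card W) ≃ W := (Fintype.equivFin W).symm
  have i : H.comap e ≃g H := Iso.comap e H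
  exact ⟨H.comap e, ⟨i⟩, Nat.card_congr i.mapEdgeSet⟩

theorem IsShallowMinor.density_mem {W V : Type*} [Fintype W] [Nonempty W] {H : SimpleGraph W}
    {G : SimpleGraph V} (h : IsShallowMinor 1 H G) :
    (H.edgeSet.ncard : ℝ) / (Fintype.card W : ℝ) ∈ G.minorDensities := by
  obtain ⟨H', ⟨i⟩, hc⟩ := exists_iso_fin H
  exact ⟨_, Fintype.card_pos, H', h.of_iso i, by rw [hc]⟩

theorem IsShallowMinor.density_mem_of_isBipartite {W V : Type*} [Fintype W] [Nonempty W]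
    {H : SimpleGraph W} {G : SimpleGraph V} (h : IsShallowMinor 1 H G) (hb : H.IsBipartite) :
    (H.edgeSet.ncard : ℝ) / (Fintype.card W : ℝ) ∈ G.bipartiteMinorDensities := by
  obtain ⟨H', ⟨i⟩, hc⟩ := exists_iso_fin H
  exact ⟨_, Fintype.card_pos, H', h.of_iso i, hb.of_hom i.toHom, by rw [hc]⟩

theorem nabla1B_le_nabla1 {V : Type*} [Finite V] (G : SimpleGraph V) : G.nabla1B ≤ G.nabla1 := by
  have h0 : 0 ≤ G.nabla1 := Real.sSup_nonneg (by rintro q ⟨n, -, H, -, rfl⟩; positivity)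
  refine Real.sSup_le ?_ h0
  rintro q ⟨n, hn, H, hM, -, rfl⟩
  exact le_csSup G.finite_minorDensities.bddAbove ⟨n, hn, H, hM, rfl⟩

theorem nabla0_le_nabla1 {V : Type*} [Finite V] (G : SimpleGraph V) : G.nabla0 ≤ G.nabla1 := by
  have h0 : 0 ≤ G.nabla1 := Real.sSup_nonneg (by rintro q ⟨n, -, H, -, rfl⟩; positivity)
  refine Real.sSup_le ?_ h0
  rintro q ⟨H, hH, rfl⟩
  have : Nonempty H.verts := hH.to_subtype
  have := Fintype.ofFinite H.verts
  refine le_csSup G.finite_minorDensities.bddAbove ?_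
  have key : IsShallowMinor 1 H.coe G := by
    refine isShallowMinor_of_stars (fun w => w.1) (fun _ => ∅) ?_ ?_
    · intro u w huw
      rw [Set.disjoint_left]
      rintro x (rfl | ⟨h, -⟩) (h' | ⟨h', -⟩)
      · exact huw (Subtype.ext h')
      all_goals simp_all
    · intro u w huw
      exact ⟨u, Or.inl rfl, w, Or.inl rfl, H.adj_sub huw⟩
  have hd := key.density_mem
  rwa [← Set.ncard_image_of_injective _ (Sym2.map.injective Subtype.val_injective),
    Subgraph.image_coe_edgeSet_coe, ← Nat.card_eq_fintype_card] at hd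

/-! ### Edge counting: independent sets and contraction onto a dominating set -/

open scoped Classical in
-- Handshaking in the subgraph induced on `X`. This is the only form in which ∇₀ enters later.
theorem sum_card_adj_le_of_nabla0_le {V : Type*} [Fintype V] {G : SimpleGraph V} {d : ℕ}
    (h : G.nabla0 ≤ d) (X : Finset V) :
    ∑ u ∈ X, {w ∈ X | G.Adj u w}.card ≤ 2 * d * X.card := by
  rcases X.eq_empty_or_nonempty with rfl | hX
  · simp
  have hmem : (((⊤ : G.Subgraph).induce X).edgeSet.ncard : ℝ) /
      (((⊤ : G.Subgraph).induce X).verts.ncard : ℝ) ∈ G.subgraphDensities :=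
    ⟨_, by simpa using hX, rfl⟩
  have hle := (le_csSup G.finite_subgraphDensities.bddAbove hmem).trans h
  have hpos : (0 : ℝ) < X.card := by exact_mod_cast hX.card_pos
  rw [Subgraph.induce_verts, Set.ncard_coe_finset, div_le_iff₀ hpos] at hle
  have hle' : ((⊤ : G.Subgraph).induce X).edgeSet.ncard ≤ d * X.card := by exact_mod_cast hle
  have hsum : ∑ u ∈ X, {w ∈ X | G.Adj u w}.card
      = 2 * ((⊤ : G.Subgraph).induce X).edgeSet.ncard := by
    set K := ((⊤ : G.Subgraph).induce X) with hK
    rw [← Subgraph.image_coe_edgeSet_coe,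
      Set.ncard_image_of_injective _ (Sym2.map.injective Subtype.val_injective),
      Set.ncard_eq_toFinset_card', ← edgeFinset, ← sum_degrees_eq_twice_card_edges]
    have hKX : ∀ x, x ∈ X ↔ x ∈ K.verts := by simp [hK]
    rw [Finset.sum_subtype X hKX]
    refine Finset.sum_congr rfl fun u _ => ?_
    rw [← card_neighborFinset_eq_degree, ← Finset.card_map (Function.Embedding.subtype _)]
    congr 1
    ext w
    have hu := (hKX u).mpr u.2
    simp only [hK, Subgraph.induce_verts, Finset.mem_filter, Function.Embedding.subtype_apply,
      Finset.mem_map, mem_neighborFinset, Subgraph.coe_adj, Subgraph.induce_adj, Subgraph.top_adj,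
      Subtype.exists, SetLike.mem_coe, exists_and_left, exists_prop, exists_eq_right_right]
    tauto
  rw [hsum, mul_assoc]
  exact Nat.mul_le_mul_left 2 hle'

open scoped Classical in
/-- A graph all of whose subgraphs have edge density at most `d` is `2d`-degenerate, hence has
large independent sets. -/
theorem exists_independent_of_sum_card_adj_le {V : Type*} {G : SimpleGraph V} {d : ℕ}
    (h : ∀ X : Finset V, ∑ u ∈ X, {w ∈ X | G.Adj u w}.card ≤ 2 * d * X.card) (X : Finset V) :
    ∃ I ⊆ X, (∀ u ∈ I, ∀ w ∈ I, ¬ G.Adj u w) ∧ X.card ≤ (2 * d + 1) * I.card := by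
  induction X using Finset.strongInduction with
  | H X ih =>
    rcases X.eq_empty_or_nonempty with rfl | hX
    · exact ⟨∅, by simp⟩
    obtain ⟨v, hv, hdeg⟩ : ∃ v ∈ X, {w ∈ X | G.Adj v w}.card ≤ 2 * d := by
      refine Finset.exists_le_of_sum_le hX ((h X).trans ?_)
      simp [mul_comm]
    -- Choosing `v` discards at most 2d + 1 vertices: itself and its neighbours in `X`.
    let Y := X.filter fun w => w ≠ v ∧ ¬ G.Adj v w
    have hYX : Y ⊂ X := Finset.filter_ssubset.mpr ⟨v, hv, by simp⟩
    obtain ⟨I, hI, hind, hcard⟩ := ih Y hYX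
    have hvI : v ∉ I := fun hvI => (Finset.mem_filter.mp (hI hvI)).2.1 rfl
    refine ⟨insert v I, Finset.insert_subset hv (hI.trans hYX.1), ?_, ?_⟩
    · intro u hu w hw
      rcases Finset.mem_insert.mp hu with rfl | hu' <;>
        rcases Finset.mem_insert.mp hw with rfl | hw'
      · exact G.loopless.irrefl _
      · exact (Finset.mem_filter.mp (hI hw')).2.2
      · exact fun hadj => (Finset.mem_filter.mp (hI hu')).2.2 hadj.symm
      · exact hind u hu' w hw'
    · have hsub : X ⊆ insert v (Y ∪ {w ∈ X | G.Adj v w}) := by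
        intro w hw
        by_cases hwv : w = v <;> by_cases ha : G.Adj v w <;> simp [Y, hw, hwv, ha]
      have h1 := (Finset.card_le_card hsub).trans (Finset.card_insert_le _ _)
      have h2 := Finset.card_union_le Y {w ∈ X | G.Adj v w}
      rw [Finset.card_insert_of_notMem hvI]
      nlinarith

open scoped Classical in
/-- An independent set outside of a dominating set `D` is small, if the neighbourhoods of its
vertices cannot be dominated by few vertices of `D`. -/
theorem card_le_of_nabla1B_lt {V : Type*} [Fintype V] {G : SimpleGraph V} {b : ℕ}
    (hb : G.nabla1B < b) {D I : Finset V} (hD : G.IsDominatingSet (D : Set V))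
    (hDI : Disjoint I D) (hI : ∀ u ∈ I, ∀ w ∈ I, ¬ G.Adj u w)
    (hrich : ∀ v ∈ I, ∀ A ⊆ D, A.card < 2 * b →
      ∃ w, G.Adj v w ∧ ∀ a ∈ A, a ≠ w ∧ ¬ G.Adj a w) :
    I.card ≤ D.card := by
  rcases I.eq_empty_or_nonempty with rfl | hne
  · simp
  choose f hfD hf using hD
  -- Vertices of `I` stay single; each vertex outside `I` and `D` joins the star of its chosen
  -- dominator.
  let S : I ⊕ D → Set V := Sum.elim (fun _ => ∅) fun d => {w | w ∉ D ∧ w ∉ I ∧ f w = d}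
  let c : I ⊕ D → V := Sum.elim Subtype.val Subtype.val
  let star : I ⊕ D → G.Subgraph := fun p => G.starSubgraph (c p) (S p)
  let T : I → D → Prop := fun v d => ∃ w ∈ (star (Sum.inr d)).verts, G.Adj v w
  let H : SimpleGraph (I ⊕ D) :=
    { Adj := fun p q => (∃ v d, p = Sum.inl v ∧ q = Sum.inr d ∧ T v d) ∨
        ∃ v d, q = Sum.inl v ∧ p = Sum.inr d ∧ T v d
      symm := ⟨fun _ _ h => h.symm⟩
      loopless := ⟨by rintro p (⟨v, d, h, h', -⟩ | ⟨v, d, h, h', -⟩) <;> simp [h] at h'⟩ }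
  have hminor : IsShallowMinor 1 H G := by
    refine isShallowMinor_of_stars c S ?_ ?_
    · have hID : ∀ (v : I) (d : D), v.1 ≠ d.1 := fun v d h =>
        Finset.disjoint_left.mp hDI v.2 (h ▸ d.2)
      rintro (u | u) (w | w) huw <;> rw [Set.disjoint_left] <;>
        rintro x (hx | ⟨hx, -⟩) (hy | ⟨hy, -⟩) <;>
        simp only [c, S, Sum.elim_inl, Sum.elim_inr] at hx hy
      · exact huw (congrArg _ (Subtype.ext (hx.symm.trans hy)))
      · exact hy
      · exact hx
      · exact hx
      · exact hID u w (hx.symm.trans hy)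
      · exact hy.2.1 (hx ▸ u.2)
      · exact hx
      · exact hx
      · exact hID w u (hy.symm.trans hx)
      · exact hy
      · exact hx.2.1 (hy ▸ w.2)
      · exact hy
      · exact huw (congrArg _ (Subtype.ext (hx.symm.trans hy)))
      · exact hy.1 (hx ▸ u.2)
      · exact hx.1 (hy ▸ w.2)
      · exact huw (congrArg _ (Subtype.ext (hx.2.2.symm.trans hy.2.2)))
    · rintro p q (⟨v, d, rfl, rfl, w, hw, ha⟩ | ⟨v, d, rfl, rfl, w, hw, ha⟩)
      · exact ⟨v, Or.inl rfl, w, hw, ha⟩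
      · exact ⟨w, hw, v, Or.inl rfl, ha.symm⟩
  have hbip : H.IsBipartite := by
    refine ⟨Coloring.mk (fun p => if p.isLeft then 0 else 1) ?_⟩
    rintro p q (⟨v, d, rfl, rfl, -⟩ | ⟨v, d, rfl, rfl, -⟩) <;> simp
  have : Nonempty (I ⊕ D) := ⟨Sum.inl ⟨hne.choose, hne.choose_spec⟩⟩
  have hlt := (le_csSup G.finite_bipartiteMinorDensities.bddAbove
    (hminor.density_mem_of_isBipartite hbip)).trans_lt hb
  have hpos : (0 : ℝ) < Fintype.card (I ⊕ D) := by exact_mod_cast Fintype.card_pos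
  rw [div_lt_iff₀ hpos] at hlt
  have hlt' : H.edgeSet.ncard < b * (I.card + D.card) := by
    have : H.edgeSet.ncard < b * Fintype.card (I ⊕ D) := by exact_mod_cast hlt
    simpa using this
  -- Otherwise the centres of the fewer than 2b stars touched by `v` dominate its neighbourhood.
  -- Independence of `I` ensures that each neighbour of `v` lies in some star.
  have hdeg : ∀ v : I, 2 * b ≤ Fintype.card {d : D // T v d} := by
    intro v
    by_contra! hlt
    let A : Finset V := (Finset.univ.filter (T v)).map (Function.Embedding.subtype _)
    have hAD : A ⊆ D := by
      intro a ha
      obtain ⟨d, -, rfl⟩ := Finset.mem_map.mp ha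
      exact d.2
    have hA : ∀ d : D, T v d → d.1 ∈ A := fun d hd =>
      Finset.mem_map.mpr ⟨d, by simpa using hd, rfl⟩
    obtain ⟨w, hvw, hw⟩ := hrich v v.2 A hAD (by simpa [A, Fintype.card_subtype] using hlt)
    by_cases hwD : w ∈ D
    · exact (hw _ (hA ⟨w, hwD⟩ ⟨w, Or.inl rfl, hvw⟩)).1 rfl
    · have hadj : G.Adj (f w) w := (hf w).resolve_left fun h => hwD (h ▸ hfD w)
      refine (hw _ (hA ⟨f w, hfD w⟩ ⟨w, Or.inr ⟨⟨hwD, ?_, rfl⟩, hadj⟩, hvw⟩)).2 hadj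
      exact fun hwI => hI v v.2 w hwI hvw
  have hedges : 2 * b * I.card ≤ H.edgeSet.ncard := by
    let g : (Σ v : I, {d : D // T v d}) → H.edgeSet := fun p =>
      ⟨s(Sum.inl p.1, Sum.inr p.2.1), Or.inl ⟨p.1, p.2.1, rfl, rfl, p.2.2⟩⟩
    have hg : Function.Injective g := by
      rintro ⟨v, d, hd⟩ ⟨v', d', hd'⟩ h
      have h' := congrArg Subtype.val h
      simp only [g, Sym2.eq_iff, Sum.inl.injEq, Sum.inr.injEq, reduceCtorEq, and_self,
        or_false] at h'
      obtain ⟨rfl, rfl⟩ := h'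
      rfl
    have h1 := Nat.card_le_card_of_injective g hg
    rw [Nat.card_eq_fintype_card, Fintype.card_sigma] at h1
    have h2 := Finset.card_nsmul_le_sum Finset.univ _ (2 * b) fun v _ => hdeg v
    simp only [Finset.card_univ, Fintype.card_coe, smul_eq_mul] at h2
    rw [mul_comm]
    exact h2.trans h1
  -- Combines 2b|I| ≤ |E(H)| < b(|I| + |D|).
  nlinarith

open scoped Classical in
theorem card_le_of_not_dominated_by {V : Type*} [Fintype V] {G : SimpleGraph V} {d b : ℕ}
    (hd : G.nabla0 ≤ d) (hb : G.nabla1B < b) {D Y : Finset V}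
    (hD : G.IsDominatingSet (D : Set V)) (hDY : Disjoint Y D)
    (hrich : ∀ v ∈ Y, ∀ A ⊆ D, A.card < 2 * b →
      ∃ w, G.Adj v w ∧ ∀ a ∈ A, a ≠ w ∧ ¬ G.Adj a w) :
    Y.card ≤ (2 * d + 1) * D.card := by
  obtain ⟨I, hIY, hI, hcard⟩ :=
    exists_independent_of_sum_card_adj_le (sum_card_adj_le_of_nabla0_le hd) Y
  refine hcard.trans (Nat.mul_le_mul_left _ ?_)
  exact card_le_of_nabla1B_lt hb hD (Finset.disjoint_of_subset_left hIY hDY) hI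
    fun v hv => hrich v (hIY hv)

end SimpleGraph

/-! ### Rich sets of vertices -/

namespace SimpleGraph

/-- The non-empty set `X` is `k`-rich if its common neighbourhood cannot be dominated by fewer
than `k` vertices outside of `X`. -/
def IsRich {V : Type*} (G : SimpleGraph V) (k : ℕ) (X : Finset V) : Prop :=
  X.Nonempty ∧ ∀ A : Finset V, Disjoint A X → A.card < k →
    ∃ w, (∀ x ∈ X, G.Adj x w) ∧ ∀ a ∈ A, a ≠ w ∧ ¬ G.Adj a w

/-- The union of the minimal `k`-rich sets with fewer than `s` elements. -/
def richCore {V : Type*} (G : SimpleGraph V) (k s : ℕ) : Set V :=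
  {v | ∃ X, Minimal (G.IsRich k) X ∧ X.card < s ∧ v ∈ X}

theorem exists_dominating_of_not_isRich {V : Type*} {G : SimpleGraph V} {k : ℕ} {X : Finset V}
    (hX : X.Nonempty) (h : ¬ G.IsRich k X) :
    ∃ A : Finset V, Disjoint A X ∧ A.card < k ∧
      ∀ w, (∀ x ∈ X, G.Adj x w) → ∃ a ∈ A, a = w ∨ G.Adj a w := by
  by_contra! hcon
  refine h ⟨hX, fun A hA hk => ?_⟩
  obtain ⟨w, hw, hAw⟩ := hcon A hA hk
  exact ⟨w, hw, fun a ha => ⟨(hAw a ha).1, (hAw a ha).2⟩⟩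

open scoped Classical in
/-- The minimal rich sets above a given set cover few vertices: a set of fewer than `k` vertices
that dominates the common neighbourhood of a set which is not rich meets all rich supersets. -/
theorem exists_cover_of_minimal_isRich {V : Type*} {G : SimpleGraph V} {k s : ℕ} (hk : 0 < k)
    (j : ℕ) (Z : Finset V) (hZ : Z.Nonempty) (hj : s ≤ Z.card + j) :
    ∃ F : Finset V, F.card + 1 ≤ k ^ j ∧
      ∀ X, Minimal (G.IsRich k) X → X.card < s → Z ⊆ X → X ⊆ Z ∪ F := by
  induction j generalizing Z with
  | zero =>
    refine ⟨∅, by simp, fun X _ hXs hZX => ?_⟩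
    have := Finset.card_le_card hZX
    omega
  | succ j ih =>
    by_cases hrich : G.IsRich k Z
    -- If `Z` is itself rich, minimality leaves only X = Z.
    · exact ⟨∅, by simpa using Nat.one_le_pow _ _ hk, fun X hX _ hZX => by
        simpa using hX.2 hrich hZX⟩
    obtain ⟨A, hAZ, hAk, hA⟩ := exists_dominating_of_not_isRich hZ hrich
    have hins : ∀ a ∈ A, s ≤ (insert a Z).card + j := fun a ha => by
      rw [Finset.card_insert_of_notMem (Finset.disjoint_left.mp hAZ ha)]
      omega
    choose! F hFcard hF using fun a (ha : a ∈ A) =>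
      ih (insert a Z) (Finset.insert_nonempty a Z) (hins a ha)
    refine ⟨A.biUnion fun a => insert a (F a), ?_, fun X hX hXs hZX => ?_⟩
    · have h1 : (A.biUnion fun a => insert a (F a)).card ≤ A.card * k ^ j :=
        Finset.card_biUnion_le_card_mul _ _ _ fun a ha =>
          (Finset.card_insert_le _ _).trans (hFcard a ha)
      -- At most k - 1 branches of size at most k^j each; the spare k^j pays for the + 1 in the
      -- invariant.
      have h2 : (A.card + 1) * k ^ j ≤ k * k ^ j := Nat.mul_le_mul_right _ hAk
      have h3 : 1 ≤ k ^ j := Nat.one_le_pow _ _ hk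
      rw [pow_succ']
      nlinarith
    -- If `A` missed `X`, it would contradict richness of `X`, whose common neighbourhood lies
    -- inside that of `Z`.
    · obtain ⟨a, haA, haX⟩ : ∃ a ∈ A, a ∈ X := by
        by_contra! hcon
        obtain ⟨w, hw, hAw⟩ := hX.1.2 A (Finset.disjoint_left.mpr hcon) hAk
        obtain ⟨a, ha, haw⟩ := hA w fun x hx => hw x (hZX hx)
        exact haw.elim (hAw a ha).1 (hAw a ha).2
      intro x hx
      have hx' := hF a haA X hX hXs (Finset.insert_subset haX hZX) hx
      simp only [Finset.mem_union, Finset.mem_insert, Finset.mem_biUnion] at hx' ⊢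
      rcases hx' with (rfl | hx') | hx'
      · exact Or.inr ⟨x, haA, Or.inl rfl⟩
      · exact Or.inl hx'
      · exact Or.inr ⟨a, haA, Or.inr hx'⟩

open scoped Classical in
-- Minimal rich sets disjoint from `D` are charged through the bipartite minor, those meeting `D`
-- through the branching bound at an element of `D`.
theorem ncard_richCore_le {V : Type*} [Fintype V] {G : SimpleGraph V} {d b s : ℕ}
    (hd : G.nabla0 ≤ d) (hb : G.nabla1B < b) (hb0 : 0 < b) {D : Finset V}
    (hD : G.IsDominatingSet (D : Set V)) :
    (G.richCore (2 * b) s).ncard ≤ (2 * d + 1 + (2 * b) ^ (s - 1)) * D.card := by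
  let Y : Finset V := {v | v ∉ D ∧ ∃ X, Minimal (G.IsRich (2 * b)) X ∧ Disjoint X D ∧ v ∈ X}
  have hY : Y.card ≤ (2 * d + 1) * D.card := by
    refine card_le_of_not_dominated_by hd hb hD
      (Finset.disjoint_left.mpr fun v hv => (Finset.mem_filter.mp hv).2.1) ?_
    intro v hv A hA hAk
    obtain ⟨-, -, X, hX, hXD, hvX⟩ := Finset.mem_filter.mp hv
    obtain ⟨w, hw, hAw⟩ := hX.1.2 A (Finset.disjoint_of_subset_left hA hXD.symm) hAk
    exact ⟨w, hw v hvX, hAw⟩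
  choose F hFcard hF using fun v : V => exists_cover_of_minimal_isRich (G := G)
    (k := 2 * b) (s := s) (by omega) (s - 1) {v} (Finset.singleton_nonempty v) (by simp; omega)
  have hsub : G.richCore (2 * b) s ⊆ ↑(Y ∪ D.biUnion fun v => {v} ∪ F v) := by
    rintro v ⟨X, hX, hXs, hvX⟩
    rw [Finset.mem_coe, Finset.mem_union]
    by_cases hXD : Disjoint X D
    · exact Or.inl (Finset.mem_filter.mpr
        ⟨Finset.mem_univ v, Finset.disjoint_left.mp hXD hvX, X, hX, hXD, hvX⟩)
    · obtain ⟨u, huX, huD⟩ := Finset.not_disjoint_iff.mp hXD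
      exact Or.inr (Finset.mem_biUnion.mpr
        ⟨u, huD, hF u X hX hXs (Finset.singleton_subset_iff.mpr huX) hvX⟩)
  refine (Set.ncard_le_ncard hsub (Finset.finite_toSet _)).trans ?_
  rw [Set.ncard_coe_finset, add_mul]
  refine (Finset.card_union_le _ _).trans (Nat.add_le_add hY ?_)
  rw [mul_comm]
  refine Finset.card_biUnion_le_card_mul _ _ _ fun v _ => (Finset.card_union_le _ _).trans ?_
  rw [Finset.card_singleton, add_comm]
  exact hFcard v

theorem completeBipartiteGraph_isContained {V : Type*} {G : SimpleGraph V} {s t : ℕ}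
    {X B : Finset V} (hX : s ≤ X.card) (hB : t ≤ B.card) (h : ∀ x ∈ X, ∀ w ∈ B, G.Adj x w) :
    (completeBipartiteGraph (Fin s) (Fin t)).IsContained G := by
  let e := (Fin.castLEEmb hX).trans X.equivFin.symm.toEmbedding
  let e' := (Fin.castLEEmb hB).trans B.equivFin.symm.toEmbedding
  have hadj : ∀ i j, G.Adj (e i) (e' j) := fun i j => h _ (e i).2 _ (e' j).2
  refine ⟨⟨⟨Sum.elim (fun i => (e i : V)) fun j => (e' j : V), ?_⟩, ?_⟩⟩
  · rintro (i | i) (j | j) hij <;> simp at hij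
    · exact hadj i j
    · exact (hadj j i).symm
  · rintro (i | i) (j | j) hij
    · exact congrArg _ (e.injective (Subtype.ext hij))
    · exact absurd hij (hadj i j).ne
    · exact absurd hij.symm (hadj j i).ne
    · exact congrArg _ (e'.injective (Subtype.ext hij))

/-- A bound for the number of vertices which have `s - j` common neighbours, none of them
dominated by the rich core, in a graph without `K_{s,t}`. -/
def residualBound (k t : ℕ) : ℕ → ℕ
  | 0 => t
  | j + 1 => k * (residualBound k t j + 1)

open scoped Classical in
-- A rich `X` with fewer than s elements would contain a minimal rich set, hence a core vertex
-- adjacent to `B`. So fewer than k vertices dominate `B`; adding any of them to `X` lowers j, and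
-- at j = 0 a large `B` would give K_{s,t}.
theorem card_lt_residualBound {V : Type*} [Finite V] {G : SimpleGraph V} {k s t : ℕ} (hk : 0 < k)
    (hfree : (completeBipartiteGraph (Fin s) (Fin t)).Free G) (j : ℕ) (X B : Finset V)
    (hX : X.Nonempty) (hj : X.card + j = s) (hXB : ∀ x ∈ X, ∀ w ∈ B, G.Adj x w)
    (hB : ∀ w ∈ B, ∀ u ∈ G.richCore k s, ¬ G.Adj u w) :
    B.card < residualBound k t j := by
  induction j generalizing X B with
  | zero =>
    by_contra! hcon
    exact hfree (completeBipartiteGraph_isContained hj.ge hcon hXB)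
  | succ j ih =>
    by_contra! hcon
    rw [residualBound] at hcon
    obtain ⟨w, hw⟩ : B.Nonempty := by
      rw [← Finset.card_pos]
      exact lt_of_lt_of_le (by positivity) hcon
    have hrich : ¬ G.IsRich k X := by
      intro hrich
      obtain ⟨Y, hYX, hY⟩ := exists_minimal_le_of_wellFoundedLT (G.IsRich k) X hrich
      obtain ⟨y, hy⟩ := hY.1.1
      have hcard := Finset.card_le_card hYX
      exact hB w hw y ⟨Y, hY, by omega, hy⟩ (hXB y (hYX hy) w hw)
    obtain ⟨A, hAX, hAk, hA⟩ := exists_dominating_of_not_isRich hX hrich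
    have hsub : B ⊆ A.biUnion fun a => insert a (B.filter (G.Adj a)) := by
      intro w hw
      obtain ⟨a, ha, haw⟩ := hA w fun x hx => hXB x hx w hw
      refine Finset.mem_biUnion.mpr ⟨a, ha, ?_⟩
      rcases haw with rfl | haw <;> simp [*]
    have hle : B.card ≤ A.card * residualBound k t j := by
      refine (Finset.card_le_card hsub).trans (Finset.card_biUnion_le_card_mul _ _ _ fun a ha => ?_)
      -- The extra 1 for `a` itself is absorbed by the strict inequality of the induction
      -- hypothesis.
      refine (Finset.card_insert_le _ _).trans (ih (insert a X) _ (Finset.insert_nonempty a X) ?_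
        ?_ fun w hw => hB w (Finset.mem_of_mem_filter w hw))
      · rw [Finset.card_insert_of_notMem (Finset.disjoint_left.mp hAX ha)]
        omega
      · intro x hx w hw
        rcases Finset.mem_insert.mp hx with rfl | hx
        · exact (Finset.mem_filter.mp hw).2
        · exact hXB x hx w (Finset.mem_of_mem_filter w hw)
    have h1 : A.card * residualBound k t j ≤ k * residualBound k t j :=
      Nat.mul_le_mul_right _ hAk.le
    nlinarith

/-! ### Primal-dual domination of the vertices that remain -/

open scoped Classical in
-- Layer cake: the weight is the sum of the indicators of its `L` level sets, and for each level set
-- `R` the edges between `S` and `R` are counted inside S ∪ R.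
theorem sum_sum_adj_le {V : Type*} [Fintype V] {G : SimpleGraph V} {d L : ℕ}
    (h : ∀ X : Finset V, ∑ u ∈ X, {w ∈ X | G.Adj u w}.card ≤ 2 * d * X.card) (S : Finset V)
    (x : V → ℕ) (hx : ∀ v, x v ≤ L) :
    ∑ u ∈ S, ∑ w with G.Adj u w, x w ≤ 2 * d * (S.card * L + ∑ w, x w) := by
  have hlayer : ∀ w, x w = ∑ j ∈ Finset.range L, if j < x w then 1 else 0 := by
    intro w
    rw [← Finset.card_filter]
    have : (Finset.range L).filter (· < x w) = Finset.range (x w) := by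
      ext j
      have := hx w
      simp only [Finset.mem_filter, Finset.mem_range]
      omega
    rw [this, Finset.card_range]
  have hunit : ∀ j, ∑ u ∈ S, ∑ w with G.Adj u w, (if j < x w then 1 else 0) ≤
      2 * d * (S.card + ∑ w, if j < x w then 1 else 0) := by
    intro j
    let R : Finset V := {w | j < x w}
    have hR : ∑ w, (if j < x w then 1 else 0) = R.card := (Finset.card_filter _ _).symm
    rw [hR]
    calc ∑ u ∈ S, ∑ w with G.Adj u w, (if j < x w then 1 else 0)
        ≤ ∑ u ∈ S, {w ∈ S ∪ R | G.Adj u w}.card := by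
          refine Finset.sum_le_sum fun u _ => ?_
          rw [← Finset.card_filter]
          refine Finset.card_le_card fun w hw => ?_
          simp only [Finset.mem_filter, Finset.mem_univ, true_and] at hw
          simp [R, hw.1, hw.2]
      _ ≤ ∑ u ∈ S ∪ R, {w ∈ S ∪ R | G.Adj u w}.card :=
          Finset.sum_le_sum_of_subset Finset.subset_union_left
      _ ≤ 2 * d * (S ∪ R).card := h _
      _ ≤ 2 * d * (S.card + R.card) := Nat.mul_le_mul_left _ (Finset.card_union_le _ _)
  calc ∑ u ∈ S, ∑ w with G.Adj u w, x w
      = ∑ j ∈ Finset.range L, ∑ u ∈ S, ∑ w with G.Adj u w, (if j < x w then 1 else 0) := by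
        rw [Finset.sum_comm]
        refine Finset.sum_congr rfl fun u _ => ?_
        rw [Finset.sum_comm]
        exact Finset.sum_congr rfl fun w _ => hlayer w
    _ ≤ ∑ j ∈ Finset.range L, 2 * d * (S.card + ∑ w, if j < x w then 1 else 0) :=
        Finset.sum_le_sum fun j _ => hunit j
    _ = 2 * d * (S.card * L + ∑ w, x w) := by
        rw [← Finset.mul_sum, Finset.sum_add_distrib, Finset.sum_comm,
          Finset.sum_congr rfl fun w _ => (hlayer w).symm]
        simp [mul_comm]

open scoped Classical in
-- Weak LP duality: every vertex charges its weight to a dominator, whose closed neighbourhood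
-- carries at most `M`.
theorem sum_le_of_isDominatingSet {V : Type*} [Fintype V] {G : SimpleGraph V} {M : ℕ}
    {D : Finset V} (hD : G.IsDominatingSet (D : Set V)) (x : V → ℕ)
    (hx : ∀ u, x u + ∑ w with G.Adj u w, x w ≤ M) : ∑ w, x w ≤ D.card * M := by
  choose f hfD hf using hD
  rw [← Finset.sum_fiberwise_of_maps_to (s := Finset.univ) (t := D) (g := f) fun w _ => hfD w]
  refine Finset.sum_le_card_nsmul _ _ _ fun u _ => le_trans ?_ (hx u)
  rw [← Finset.sum_insert (by simp)]
  refine Finset.sum_le_sum_of_subset fun w hw => ?_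
  have hw' : f w = u := by simpa using hw
  rcases hf w with h | h
  · simp [← hw', h]
  · simp [← hw', h]

open scoped Classical in
/-- Doubling the weights of the undominated vertices until they are dominated by vertices with
heavy neighbourhoods yields a constant factor approximation in graphs of bounded density. -/
theorem card_primalDual_le {V : Type*} [Fintype V] {G : SimpleGraph V} {d M m : ℕ}
    (hd : ∀ X : Finset V, ∑ u ∈ X, {w ∈ X | G.Adj u w}.card ≤ 2 * d * X.card)
    {D R : Finset V} (hD : G.IsDominatingSet (D : Set V)) {x : ℕ → V → ℕ} {U S : ℕ → Finset V}
    (hM : M = 2 ^ m * (8 * (d + 1))) (hR : ∀ v, {w ∈ R | G.Adj v w}.card < 2 ^ m)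
    (hx0 : ∀ v, x 0 v = if v ∈ R then 1 else 0) (hU0 : U 0 = R)
    (hS : ∀ i u, u ∈ S i ↔ M ≤ 2 * (x i u + ∑ w with G.Adj u w, x i w))
    (hU : ∀ i w, w ∈ U (i + 1) ↔ w ∈ U i ∧ w ∉ S i ∧ ∀ u, G.Adj w u → u ∉ S i)
    (hx : ∀ i w, x (i + 1) w = if w ∈ U (i + 1) then 2 * x i w else x i w) :
    ((Finset.range m).biUnion S ∪ U m).card ≤ 16 * (d + 1) * D.card := by
  let load : ℕ → V → ℕ := fun i u => x i u + ∑ w with G.Adj u w, x i w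
  have hmono : ∀ w, Monotone fun i => x i w := fun w => monotone_nat_of_le_succ fun i => by
    rw [hx]
    split_ifs <;> omega
  have hdouble : ∀ i w, x (i + 1) w ≤ 2 * x i w := fun i w => by
    rw [hx]
    split_ifs <;> omega
  have hload : ∀ i u, load i u ≤ M := by
    intro i
    induction i with
    | zero =>
      intro u
      have h1 : x 0 u ≤ 1 := by rw [hx0]; split_ifs <;> omega
      have h2 : ∑ w with G.Adj u w, x 0 w = {w ∈ R | G.Adj u w}.card := by
        simp only [hx0]
        rw [← Finset.card_filter, Finset.filter_filter]
        congr 1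
        ext w
        simp [and_comm]
      have h3 := hR u
      have h4 : 2 ^ m * 1 ≤ 2 ^ m * (8 * (d + 1)) := Nat.mul_le_mul_left _ (by omega)
      simp only [load]
      omega
    | succ i ih =>
      intro u
      by_cases hu : u ∈ S i
      · have h1 : x (i + 1) u = x i u := by
          rw [hx, if_neg fun h => ((hU i u).mp h).2.1 hu]
        have h2 : ∑ w with G.Adj u w, x (i + 1) w = ∑ w with G.Adj u w, x i w := by
          refine Finset.sum_congr rfl fun w hw => ?_
          rw [hx, if_neg fun h =>
            ((hU i w).mp h).2.2 u (Finset.mem_filter.mp hw).2.symm hu]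
        simp only [load, h1, h2]
        exact ih u
      · rw [hS, not_le] at hu
        have h1 := hdouble i u
        have h2 : ∑ w with G.Adj u w, x (i + 1) w ≤ 2 * ∑ w with G.Adj u w, x i w := by
          rw [Finset.mul_sum]
          exact Finset.sum_le_sum fun w _ => hdouble i w
        simp only [load]
        omega
  have hle : ∀ i w, x i w ≤ 2 ^ i := by
    intro i w
    induction i with
    | zero => rw [hx0]; split_ifs <;> simp
    | succ i ih => exact (hdouble i w).trans (by rw [pow_succ']; omega)
  have heq : ∀ i, ∀ w ∈ U i, x i w = 2 ^ i := by
    intro i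
    induction i with
    | zero => intro w hw; rw [hx0, if_pos (hU0 ▸ hw), pow_zero]
    | succ i ih => intro w hw; rw [hx, if_pos hw, ih w ((hU i w).mp hw).1, pow_succ']
  have hpack : ∑ w, x m w ≤ D.card * M := sum_le_of_isDominatingSet hD (x m) (hload m)
  set T := (Finset.range m).biUnion S
  have hheavy : ∀ u ∈ T, M ≤ 2 * load m u := by
    intro u hu
    obtain ⟨i, hi, hui⟩ := Finset.mem_biUnion.mp hu
    have him : i ≤ m := (Finset.mem_range.mp hi).le
    refine ((hS i u).mp hui).trans (Nat.mul_le_mul_left 2 (Nat.add_le_add (hmono u him) ?_))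
    exact Finset.sum_le_sum fun w _ => hmono w him
  -- Loads never decrease, so members of `T` remain heavy and their loads can be summed at time m.
  -- The term 4d·2^m·|T| on the right is at most half of M|T|, because M contains the factor 8(d +
  -- 1).
  have hT : T.card * M ≤ 2 * (∑ w, x m w + 2 * d * (T.card * 2 ^ m + ∑ w, x m w)) := by
    refine (Finset.card_nsmul_le_sum T _ M hheavy).trans ?_
    rw [← Finset.mul_sum]
    refine Nat.mul_le_mul_left 2 ?_
    rw [Finset.sum_add_distrib]
    exact Nat.add_le_add (Finset.sum_le_sum_of_subset (Finset.subset_univ T))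
      (sum_sum_adj_le hd T (x m) (hle m))
  -- A vertex that is still undominated has doubled in every iteration.
  have hUm : (U m).card * 2 ^ m ≤ ∑ w, x m w := by
    rw [← smul_eq_mul, ← Finset.sum_const]
    exact (Finset.sum_congr rfl fun w hw => (heq m w hw).symm).trans_le
      (Finset.sum_le_sum_of_subset (Finset.subset_univ _))
  have hp : 0 < 2 ^ m := by positivity
  subst hM
  have hU' : (U m).card ≤ 8 * (d + 1) * D.card := by
    refine Nat.le_of_mul_le_mul_right ?_ hp
    calc _ ≤ _ := hUm.trans hpack
      _ = _ := by ring
  have hT' : T.card ≤ 8 * (d + 1) * D.card := by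
    refine Nat.le_of_mul_le_mul_right (c := 2 ^ m * (4 * d + 8)) ?_ (by positivity)
    have h1 : (4 * d + 2) * ∑ w, x m w ≤ (4 * d + 8) * (D.card * (2 ^ m * (8 * (d + 1)))) :=
      Nat.mul_le_mul (by omega) hpack
    nlinarith
  calc _ ≤ T.card + (U m).card := Finset.card_union_le _ _
    _ ≤ _ := by nlinarith

end SimpleGraph

/-! ### Locality of the rich core -/

namespace SimpleGraph

variable {V W : Type*} {G : SimpleGraph V} {H : SimpleGraph W} {e : V ↪ W}

theorem adj_of_map_adj (hH : ∀ m n, H.Adj m n → ∃ u w, e u = m ∧ e w = n ∧ G.Adj u w) {u w : V}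
    (h : H.Adj (e u) (e w)) : G.Adj u w := by
  obtain ⟨u', w', hu, hw, hadj⟩ := hH _ _ h
  rwa [e.injective hu, e.injective hw] at hadj

open scoped Classical in
-- Taking A = ∅, which needs k > 0, shows that a rich set has a common neighbour; its members thus
-- have edges and come from `G`.
theorem exists_map_eq_of_isRich (hH : ∀ m n, H.Adj m n → ∃ u w, e u = m ∧ e w = n ∧ G.Adj u w)
    {k : ℕ} (hk : 0 < k) {Z : Finset W} (hZ : H.IsRich k Z) : ∃ Y : Finset V, Y.map e = Z := by
  obtain ⟨n, hn, -⟩ := hZ.2 ∅ (Finset.disjoint_empty_left _) (by simpa)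
  refine ⟨Z.preimage e e.injective.injOn, ?_⟩
  rw [Finset.map_eq_image, Finset.image_preimage, Finset.filter_true_of_mem]
  intro z hz
  obtain ⟨u, -, hu, -, -⟩ := hH _ _ (hn z hz)
  exact ⟨u, hu⟩

open scoped Classical in
/-- Whether a set that contains `y` is rich depends only on the edges at vertices which have a
common neighbour with `y`. -/
theorem isRich_map_iff (hH : ∀ m n, H.Adj m n → ∃ u w, e u = m ∧ e w = n ∧ G.Adj u w)
    {Y : Finset V} {y : V} (hy : y ∈ Y)
    (hloc : ∀ w u, G.Adj y w → G.Adj u w → H.Adj (e u) (e w)) {k : ℕ} :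
    H.IsRich k (Y.map e) ↔ G.IsRich k Y := by
  constructor
  · refine fun h => ⟨⟨y, hy⟩, fun A hA hAk => ?_⟩
    obtain ⟨n, hn, hAn⟩ := h.2 (A.map e) ((Finset.disjoint_map e).mpr hA) (by simpa using hAk)
    obtain ⟨-, w, -, rfl, -⟩ := hH _ _ (hn (e y) (Finset.mem_map_of_mem e hy))
    have hYw : ∀ x ∈ Y, G.Adj x w := fun x hx =>
      adj_of_map_adj hH (hn (e x) (Finset.mem_map_of_mem e hx))
    refine ⟨w, hYw, fun a ha => ?_⟩
    obtain ⟨h1, h2⟩ := hAn (e a) (Finset.mem_map_of_mem e ha)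
    exact ⟨fun h => h1 (congrArg e h), fun h => h2 (hloc w a (hYw y hy) h)⟩
  · refine fun h => ⟨⟨e y, Finset.mem_map_of_mem e hy⟩, fun A hA hAk => ?_⟩
    let A' : Finset V := A.preimage e e.injective.injOn
    have hA' : A'.card ≤ A.card := by
      rw [← Finset.card_map e]
      exact Finset.card_le_card (Finset.map_subset_iff_subset_preimage.mpr subset_rfl)
    obtain ⟨w, hw, hAw⟩ := h.2 A' (Finset.disjoint_left.mpr fun a ha haY =>
      Finset.disjoint_left.mp hA (Finset.mem_preimage.mp ha) (Finset.mem_map_of_mem e haY))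
      (hA'.trans_lt hAk)
    refine ⟨e w, fun x hx => ?_, fun a ha => ⟨?_, fun haw => ?_⟩⟩
    · obtain ⟨x, hx', rfl⟩ := Finset.mem_map.mp hx
      exact hloc w x (hw y hy) (hw x hx')
    · rintro rfl
      exact (hAw w (Finset.mem_preimage.mpr ha)).1 rfl
    · obtain ⟨u, -, rfl, -, -⟩ := hH _ _ haw
      exact (hAw u (Finset.mem_preimage.mpr ha)).2 (adj_of_map_adj hH haw)

/-- All members of a rich set containing v share a neighbour with v. Testing its minimality involves
subsets of it, their common neighbours, and the neighbours of those: four steps from v. -/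
theorem mem_richCore_iff_of_local
    (hH : ∀ m n, H.Adj m n → ∃ u w, e u = m ∧ e w = n ∧ G.Adj u w) {v : V}
    (hloc : ∀ w y w' u, G.Adj v w → G.Adj y w → G.Adj y w' → G.Adj u w' → H.Adj (e u) (e w'))
    {k s : ℕ} (hk : 0 < k) : e v ∈ H.richCore k s ↔ v ∈ G.richCore k s := by
  have hv : ∀ w u, G.Adj v w → G.Adj u w → H.Adj (e u) (e w) :=
    fun w u hw hu => hloc w v w u hw hw hw hu
  have hsub : ∀ Y Y', v ∈ Y → G.IsRich k Y → Y' ⊆ Y → (H.IsRich k (Y'.map e) ↔ G.IsRich k Y') := by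
    intro Y Y' hvY hY hY'
    rcases Y'.eq_empty_or_nonempty with rfl | ⟨y, hy⟩
    · simp [IsRich]
    obtain ⟨w, hw, -⟩ := hY.2 ∅ (Finset.disjoint_empty_left _) (by simpa)
    exact isRich_map_iff hH hy fun w' u => hloc w y w' u (hw v hvY) (hw y (hY' hy))
  constructor
  · rintro ⟨Z, hZ, hZs, hvZ⟩
    obtain ⟨Y, rfl⟩ := exists_map_eq_of_isRich hH hk hZ.1
    have hvY : v ∈ Y := (Finset.mem_map' e).mp hvZ
    have hY := (isRich_map_iff hH hvY hv).mp hZ.1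
    refine ⟨Y, ⟨hY, fun Y' hY' hle => ?_⟩, by simpa using hZs, hvY⟩
    exact Finset.map_subset_map.mp
      (hZ.2 ((hsub Y Y' hvY hY hle).mpr hY') (Finset.map_subset_map.mpr hle))
  · rintro ⟨Y, hY, hYs, hvY⟩
    refine ⟨Y.map e, ⟨(isRich_map_iff hH hvY hv).mpr hY.1, fun Z hZ hle => ?_⟩, by simpa using hYs,
      Finset.mem_map_of_mem e hvY⟩
    obtain ⟨Y', rfl⟩ := exists_map_eq_of_isRich hH hk hZ
    have hle' := Finset.map_subset_map.mp hle
    exact Finset.map_subset_map.mpr (hY.2 ((hsub Y Y' hvY hY.1 hle').mp hZ) hle')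

end SimpleGraph

/-! ### The algorithm -/

/-- The identifiers of a node and of its neighbours. -/
def NodeMap.row.{u} : NodeMap.{u} (ℕ × Set ℕ) :=
  NodeMap.identifier.step fun n l => (n, {m | m ∈ l})

/-- The identifier of a node, with the rows of all nodes at distance at most `j`. -/
def NodeMap.view.{u} : ℕ → NodeMap.{u} (ℕ × Set (ℕ × Set ℕ))
  | 0 => NodeMap.row.step fun p _ => (p.1, {p})
  | j + 1 => (NodeMap.view j).step fun p l => (p.1, p.2 ∪ {q | ∃ p' ∈ l, q ∈ p'.2})

/-- The graph on the identifiers that is described by a set of rows. -/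
def knownGraph (K : Set (ℕ × Set ℕ)) : SimpleGraph ℕ :=
  SimpleGraph.fromRel fun m n => ∃ p ∈ K, p.1 = m ∧ n ∈ p.2

/-- Membership in the rich core, as computed from the view of radius `4`. -/
def NodeMap.inRichCore.{u} (k s : ℕ) : NodeMap.{u} Prop :=
  (NodeMap.view 4).step fun p _ => p.1 ∈ (knownGraph p.2).richCore k s

/-- The state of a node in the primal-dual phase. -/
structure DominationState where
  selected : Prop
  undominated : Prop
  weight : ℕ

open scoped Classical in
/-- The state at the start of the primal-dual phase. -/
noncomputable def NodeMap.initialState.{u} (k s : ℕ) : NodeMap.{u} DominationState :=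
  (NodeMap.inRichCore k s).step fun c l =>
    ⟨c, ¬ c ∧ ∀ q ∈ l, ¬ q, if ¬ c ∧ ∀ q ∈ l, ¬ q then 1 else 0⟩

/-- The state of a node, and whether its closed neighbourhood has weight at least `M / 2`. -/
def NodeMap.withHeavy.{u} (M : ℕ) (f : NodeMap.{u} DominationState) :
    NodeMap.{u} (DominationState × Prop) :=
  f.step fun σ l => (σ, M ≤ 2 * (σ.weight + (l.map DominationState.weight).sum))

open scoped Classical in
/-- Select the heavy nodes and double the weights of the nodes that remain undominated. -/
noncomputable def NodeMap.selectHeavy.{u} (f : NodeMap.{u} (DominationState × Prop)) :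
    NodeMap.{u} DominationState :=
  f.step fun σ l => ⟨σ.1.selected ∨ σ.2, σ.1.undominated ∧ ¬ σ.2 ∧ ∀ q ∈ l, ¬ q.2,
    if σ.1.undominated ∧ ¬ σ.2 ∧ ∀ q ∈ l, ¬ q.2 then 2 * σ.1.weight else σ.1.weight⟩

/-- The state after `i` iterations of the primal-dual phase. -/
noncomputable def NodeMap.primalDual.{u} (k s M : ℕ) : ℕ → NodeMap.{u} DominationState
  | 0 => NodeMap.initialState k s
  | i + 1 => ((NodeMap.primalDual k s M i).withHeavy M).selectHeavy

open scoped Classical in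
/-- The output of the algorithm: the selected nodes and those that remain undominated. -/
noncomputable def NodeMap.dominating.{u} (k s M m : ℕ) : NodeMap.{u} Bool :=
  (NodeMap.primalDual k s M m).step fun σ _ => decide (σ.selected ∨ σ.undominated)

/-! ### Round counts -/

theorem NodeMap.locallyComputable_view.{u} (j : ℕ) :
    (NodeMap.view.{u} j).LocallyComputable (j + 2) := by
  induction j with
  | zero => exact (NodeMap.locallyComputable_identifier.step _).step _
  | succ j ih => exact ih.step _

theorem NodeMap.locallyComputable_primalDual.{u} (k s M i : ℕ) :
    (NodeMap.primalDual.{u} k s M i).LocallyComputable (2 * i + 8) := by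
  induction i with
  | zero =>
    unfold NodeMap.primalDual NodeMap.initialState NodeMap.inRichCore
    exact ((NodeMap.locallyComputable_view 4).step _).step _
  | succ i ih =>
    unfold NodeMap.primalDual NodeMap.selectHeavy NodeMap.withHeavy
    exact (ih.step _).step _

theorem NodeMap.locallyComputable_dominating.{u} (k s M m : ℕ) :
    (NodeMap.dominating.{u} k s M m).LocallyComputable (2 * m + 9) :=
  (NodeMap.locallyComputable_primalDual k s M m).step _

/-! ### Correctness of the views -/

section

variable {V : Type*} {G : SimpleGraph V} (P : PortNumbering G) (ident : V → ℕ)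

theorem NodeMap.row_eq (v : V) :
    NodeMap.row V G P ident v = (ident v, ident '' G.neighborSet v) := by
  refine Prod.ext rfl (Set.ext fun m => ?_)
  exact P.mem_ofFn_port ident v m

theorem NodeMap.view_fst (j : ℕ) (v : V) : (NodeMap.view j V G P ident v).1 = ident v := by
  induction j with
  | zero => rfl
  | succ j ih => exact ih

theorem NodeMap.mem_view_succ (j : ℕ) (v : V) (q : ℕ × Set ℕ) :
    q ∈ (NodeMap.view (j + 1) V G P ident v).2 ↔ q ∈ (NodeMap.view j V G P ident v).2 ∨
      ∃ u, G.Adj v u ∧ q ∈ (NodeMap.view j V G P ident u).2 := by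
  refine or_congr_right ⟨?_, ?_⟩
  · rintro ⟨p, hp, hq⟩
    obtain ⟨u, hu, rfl⟩ := (P.mem_ofFn_port _ v p).mp hp
    exact ⟨u, hu, hq⟩
  · rintro ⟨u, hu, hq⟩
    exact ⟨_, (P.mem_ofFn_port _ v _).mpr ⟨u, hu, rfl⟩, hq⟩

theorem NodeMap.exists_row_eq_of_mem_view (j : ℕ) (v : V) (q : ℕ × Set ℕ)
    (hq : q ∈ (NodeMap.view j V G P ident v).2) : ∃ u, NodeMap.row V G P ident u = q := by
  induction j generalizing v with
  | zero => exact ⟨v, hq.symm⟩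
  | succ j ih =>
    rcases (NodeMap.mem_view_succ P ident j v q).mp hq with h | ⟨u, -, h⟩
    · exact ih v h
    · exact ih u h

theorem NodeMap.row_mem_view_four {v w y w' u : V} (h1 : G.Adj v w) (h2 : G.Adj w y)
    (h3 : G.Adj y w') (h4 : G.Adj w' u) :
    NodeMap.row V G P ident u ∈ (NodeMap.view 4 V G P ident v).2 := by
  refine (NodeMap.mem_view_succ P ident _ _ _).mpr (Or.inr ⟨w, h1, ?_⟩)
  refine (NodeMap.mem_view_succ P ident _ _ _).mpr (Or.inr ⟨y, h2, ?_⟩)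
  refine (NodeMap.mem_view_succ P ident _ _ _).mpr (Or.inr ⟨w', h3, ?_⟩)
  exact (NodeMap.mem_view_succ P ident _ _ _).mpr (Or.inr ⟨u, h4, rfl⟩)

/-- The known graph lives on all of ℕ; numbers that are not identifiers are isolated in it and
cannot affect richness. -/
theorem NodeMap.inRichCore_iff {k : ℕ} (hk : 0 < k) (s : ℕ) (hid : Function.Injective ident)
    (v : V) : NodeMap.inRichCore k s V G P ident v ↔ v ∈ G.richCore k s := by
  change (NodeMap.view 4 V G P ident v).1 ∈ _ ↔ _
  rw [NodeMap.view_fst]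
  refine SimpleGraph.mem_richCore_iff_of_local (e := ⟨ident, hid⟩) ?_ ?_ hk
  · have key : ∀ m n, (∃ p ∈ (NodeMap.view 4 V G P ident v).2, p.1 = m ∧ n ∈ p.2) →
        ∃ u w, ident u = m ∧ ident w = n ∧ G.Adj u w := by
      rintro m n ⟨p, hp, rfl, hn⟩
      obtain ⟨u, rfl⟩ := NodeMap.exists_row_eq_of_mem_view P ident 4 v p hp
      rw [NodeMap.row_eq] at hn ⊢
      obtain ⟨w, hw, rfl⟩ := hn
      exact ⟨u, w, rfl, rfl, hw⟩
    rintro m n ⟨-, h | h⟩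
    · exact key m n h
    · obtain ⟨u, w, hu, hw, hadj⟩ := key n m h
      exact ⟨w, u, hw, hu, hadj.symm⟩
  · intro w y w' u h1 h2 h3 h4
    refine ⟨fun h => h4.ne (hid h), Or.inl
      ⟨_, NodeMap.row_mem_view_four P ident h1 h2.symm h3 h4.symm, rfl, ?_⟩⟩
    rw [NodeMap.row_eq]
    exact ⟨w', h4, rfl⟩

end

/-! ### The approximation guarantee -/

open scoped Classical in
theorem NodeMap.dominating_spec {V : Type*} [Fintype V] {G : SimpleGraph V} {d b s t m : ℕ}
    (hd : G.nabla0 ≤ d) (hb : G.nabla1B < b) (hb0 : 0 < b) (hs : 1 ≤ s)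
    (hfree : (completeBipartiteGraph (Fin s) (Fin t)).Free G)
    (hm : SimpleGraph.residualBound (2 * b) t (s - 1) ≤ 2 ^ m) (P : PortNumbering G) {ident : V → ℕ}
    (hid : Function.Injective ident) {D : Finset V} (hD : G.IsDominatingSet (D : Set V)) :
    G.IsDominatingSet {v | NodeMap.dominating (2 * b) s (2 ^ m * (8 * (d + 1))) m V G P ident v =
      true} ∧
    {v | NodeMap.dominating (2 * b) s (2 ^ m * (8 * (d + 1))) m V G P ident v = true}.ncard ≤
      (2 * d + 1 + (2 * b) ^ (s - 1) + 16 * (d + 1)) * D.card := by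
  set M := 2 ^ m * (8 * (d + 1)) with hM
  let σ : ℕ → V → DominationState := fun i => NodeMap.primalDual (2 * b) s M i V G P ident
  let heavy : ℕ → V → Prop := fun i v =>
    ((NodeMap.primalDual (2 * b) s M i).withHeavy M V G P ident v).2
  let U : ℕ → Finset V := fun i => {v | (σ i v).undominated}
  let S : ℕ → Finset V := fun i => {v | heavy i v}
  have hcore : ∀ v, (σ 0 v).selected ↔ v ∈ G.richCore (2 * b) s :=
    NodeMap.inRichCore_iff P ident (by omega) s hid
  have hund : ∀ v, (σ 0 v).undominated ↔
      v ∉ G.richCore (2 * b) s ∧ ∀ u, G.Adj v u → u ∉ G.richCore (2 * b) s := by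
    intro v
    refine and_congr (not_congr (hcore v)) ⟨fun h u hu hc => ?_, fun h q hq hq' => ?_⟩
    · exact h _ ((P.mem_ofFn_port _ v _).mpr ⟨u, hu, rfl⟩) ((hcore u).mpr hc)
    · obtain ⟨u, hu, rfl⟩ := (P.mem_ofFn_port _ v q).mp hq
      exact h u hu ((hcore u).mp hq')
  have hheavy : ∀ i u, u ∈ S i ↔
      M ≤ 2 * ((σ i u).weight + ∑ w with G.Adj u w, (σ i w).weight) := by
    intro i u
    rw [← P.sum_ofFn_port fun w => (σ i w).weight, Finset.mem_filter_univ]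
    change M ≤ 2 * ((σ i u).weight + (List.map _ (List.ofFn _)).sum) ↔ _
    rw [List.map_ofFn]
    rfl
  have hU : ∀ i w, w ∈ U (i + 1) ↔ w ∈ U i ∧ w ∉ S i ∧ ∀ u, G.Adj w u → u ∉ S i := by
    intro i w
    simp only [U, S, Finset.mem_filter_univ]
    refine and_congr Iff.rfl (and_congr Iff.rfl ⟨fun h u hu hc => ?_, fun h q hq hq' => ?_⟩)
    · exact h _ ((P.mem_ofFn_port _ w _).mpr ⟨u, hu, rfl⟩) hc
    · obtain ⟨u, hu, rfl⟩ := (P.mem_ofFn_port _ w q).mp hq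
      exact h u hu hq'
  have hx : ∀ i w, (σ (i + 1) w).weight =
      if w ∈ U (i + 1) then 2 * (σ i w).weight else (σ i w).weight := by
    intro i w
    simp only [U, Finset.mem_filter_univ]
    split_ifs with h
    · exact if_pos h
    · exact if_neg h
  have hsel : ∀ i v, (σ i v).selected ↔
      v ∈ G.richCore (2 * b) s ∨ v ∈ (Finset.range i).biUnion S := by
    intro i v
    induction i with
    | zero => simpa using hcore v
    | succ i ih =>
      have h : (σ (i + 1) v).selected ↔ (σ i v).selected ∨ heavy i v := Iff.rfl
      rw [h, ih, Finset.range_add_one, Finset.biUnion_insert, Finset.mem_union, or_assoc]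
      simp only [S, Finset.mem_filter_univ, or_comm]
  -- The residual bound is started with X = {v}, hence with j = s - 1.
  have hR : ∀ v, {w ∈ U 0 | G.Adj v w}.card < 2 ^ m := by
    intro v
    refine (SimpleGraph.card_lt_residualBound (by omega) hfree (s - 1) {v} _
      (Finset.singleton_nonempty v) (by simp; omega) ?_ ?_).trans_le hm
    · intro x hx w hw
      rw [Finset.mem_singleton.mp hx]
      exact (Finset.mem_filter.mp hw).2
    · intro w hw u hu huw
      have hwU : (σ 0 w).undominated := by simpa [U] using (Finset.mem_filter.mp hw).1
      exact ((hund w).mp hwU).2 u huw.symm hu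
  have hcard := SimpleGraph.card_primalDual_le (x := fun i v => (σ i v).weight)
    (SimpleGraph.sum_card_adj_le_of_nabla0_le hd) hD hM hR (fun v => by
      simp only [U, Finset.mem_filter_univ]
      split_ifs with h
      · exact if_pos h
      · exact if_neg h) rfl hheavy hU hx
  have hout : {v | NodeMap.dominating (2 * b) s M m V G P ident v = true} =
      G.richCore (2 * b) s ∪ ↑((Finset.range m).biUnion S ∪ U m) := by
    ext v
    have h : NodeMap.dominating (2 * b) s M m V G P ident v = true ↔
      (σ m v).selected ∨ (σ m v).undominated := decide_eq_true_iff
    rw [Set.mem_ofPred_eq, h, hsel, Finset.coe_union, Set.mem_union, Set.mem_union, or_assoc]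
    simp [U]
  rw [hout]
  constructor
  -- A vertex leaves `U` only when it or a neighbour is selected.
  · have hprogress : ∀ i w, w ∈ U 0 → w ∈ U i ∨
        ∃ u ∈ (Finset.range i).biUnion S, u = w ∨ G.Adj u w := by
      intro i w hw
      induction i with
      | zero => exact Or.inl hw
      | succ i ih =>
        rcases ih with h | ⟨u, hu, huw⟩
        · by_cases hS : w ∈ S i
          · exact Or.inr ⟨w, Finset.mem_biUnion.mpr ⟨i, by simp, hS⟩, Or.inl rfl⟩
          by_cases hN : ∀ u, G.Adj w u → u ∉ S i
          · exact Or.inl ((hU i w).mpr ⟨h, hS, hN⟩)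
          · push Not at hN
            obtain ⟨u, hwu, hu⟩ := hN
            exact Or.inr ⟨u, Finset.mem_biUnion.mpr ⟨i, by simp, hu⟩, Or.inr hwu.symm⟩
        · exact Or.inr ⟨u, Finset.biUnion_subset_biUnion_of_subset_left _
            (Finset.range_mono (Nat.le_succ i)) hu, huw⟩
    intro w
    by_cases hw : (σ 0 w).undominated
    · rcases hprogress m w (by simpa [U] using hw) with h | ⟨u, hu, huw⟩
      · exact ⟨w, Or.inr (Finset.mem_union_right _ h), Or.inl rfl⟩
      · exact ⟨u, Or.inr (Finset.mem_union_left _ hu), huw⟩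
    · rw [hund] at hw
      by_cases hwc : w ∈ G.richCore (2 * b) s
      · exact ⟨w, Or.inl hwc, Or.inl rfl⟩
      · push Not at hw
        obtain ⟨u, hwu, hu⟩ := hw hwc
        exact ⟨u, Or.inl hu, Or.inr hwu.symm⟩
  · refine (Set.ncard_union_le _ _).trans ?_
    rw [Set.ncard_coe_finset, add_mul]
    exact Nat.add_le_add (SimpleGraph.ncard_richCore_le hd hb hb0 hD) hcard

/-! ### Comparison of the approximation factors -/

theorem le_approxFactor {d b s : ℕ} (hb : 0 < b) (hs : 1 ≤ s) :
    2 * d + 1 + (2 * b) ^ (s - 1) + 16 * (d + 1) ≤ approxFactor d b s := by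
  have hk : 2 * b ≤ kappa d b := le_max_right _ _
  unfold approxFactor
  set k := kappa d b
  have hk2 : 2 ≤ k := by omega
  have h1 : (2 * b) ^ (s - 1) ≤ k ^ (s - 1) := Nat.pow_le_pow_left hk _
  -- Since k ≥ 2, the exponent 2sk is at least 4s ≥ s + 3; the spare k^4 ≥ 16 pays for the
  -- primal-dual phase.
  have h2 : k ^ (s - 1 + 4) ≤ k ^ (2 * s * k) :=
    Nat.pow_le_pow_right (by omega) (by
      have : 2 * s * 2 ≤ 2 * s * k := Nat.mul_le_mul_left _ hk2
      omega)
  have h3 : 2 ^ 4 ≤ k ^ 4 := Nat.pow_le_pow_left hk2 4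
  have h4 : 1 ≤ k ^ (s - 1) := Nat.one_le_pow _ _ (by omega)
  rw [pow_add] at h2
  have h5 : k ^ (s - 1) * 16 ≤ k ^ (2 * s * k) := (Nat.mul_le_mul_left _ h3).trans h2
  nlinarith [Nat.zero_le (d * k ^ (s - 1)), Nat.mul_le_mul_left d h5, Nat.mul_le_mul_left d h4]

theorem approxFactor_le {d d₀ b s : ℕ} (hd₀ : d₀ ≤ d) (hb : b ≤ d + 1) (hs : s ≤ 2 * d + 1) :
    approxFactor d₀ b s ≤ (2 * (d + 1)) ^ (2 * (2 * (d + 1)) ^ 2) + 2 * (d + 1) := by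
  have hk : kappa d₀ b ≤ 2 * (d + 1) := max_le (by omega) (by omega)
  unfold approxFactor
  have hd' : 2 * (d₀ + 1) ≤ 2 * (d + 1) := by omega
  have hs' : s + 1 ≤ 2 * (d + 1) := by omega
  have hc : 2 ≤ 2 * (d + 1) := by omega
  generalize 2 * (d + 1) = c at *
  have h1 : kappa d₀ b ^ (2 * s * kappa d₀ b) ≤ c ^ (2 * s * c) :=
    (Nat.pow_le_pow_left hk _).trans
      (Nat.pow_le_pow_right (by omega) (Nat.mul_le_mul_left _ hk))
  -- From s + 1 ≤ c, 2c² ≥ 2sc + 2c; the spare c² absorbs the leading factor and the additive 2.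
  have h2 : c ^ (2 * s * c + 2) ≤ c ^ (2 * c ^ 2) :=
    Nat.pow_le_pow_right (by omega) (by nlinarith [Nat.mul_le_mul_right c hs'])
  have h3 : 1 ≤ c ^ (2 * s * c) := Nat.one_le_pow _ _ (by omega)
  rw [pow_add] at h2
  calc 2 * (d₀ + 1) * (kappa d₀ b ^ (2 * s * kappa d₀ b) + 2) ≤ c * (c ^ (2 * s * c) + 2) :=
        Nat.mul_le_mul hd' (by omega)
    _ ≤ c ^ (2 * s * c) * c ^ 2 + c := by
        have h4 : c * c ^ (2 * s * c) * 2 ≤ c * c ^ (2 * s * c) * c := Nat.mul_le_mul_left _ hc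
        have h5 : c * 1 ≤ c * c ^ (2 * s * c) := Nat.mul_le_mul_left _ h3
        nlinarith
    _ ≤ _ := by omega

/-! ### Assembling the theorem -/

/-- A number of rounds that suffices for the parameters `b`, `s` and `t`. -/
def roundBound (b s t : ℕ) : ℕ :=
  2 * SimpleGraph.residualBound (2 * b) t (s - 1) + 9

theorem exists_approximatesDominatingSet.{u} (d b s t : ℕ) (hs : 1 ≤ s) {r : ℕ}
    (hr : roundBound b s t ≤ r) :
    ∃ A : LocalAlgorithm Bool, ∀ (V : Type u) [Finite V] (G : SimpleGraph V),
      G.nabla0 ≤ d → G.nabla1B < b → (completeBipartiteGraph (Fin s) (Fin t)).Free G →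
        A.ApproximatesDominatingSet r (approxFactor d b s) G := by
  -- Only 2^m has to reach the residual bound, and n < 2^n, so the bound itself serves as the number
  -- of iterations.
  let m := SimpleGraph.residualBound (2 * b) t (s - 1)
  obtain ⟨A, hA⟩ := (NodeMap.locallyComputable_dominating.{u} (2 * b) s
    (2 ^ m * (8 * (d + 1))) m).mono hr
  refine ⟨A, fun V _ G hd hb hfree P ident hid => ?_⟩
  have := Fintype.ofFinite V
  have hb0 : 0 < b := by
    have h0 : 0 ≤ G.nabla1B := Real.sSup_nonneg (by rintro q ⟨n, -, H, -, -, rfl⟩; positivity)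
    exact_mod_cast h0.trans_lt hb
  have hne : {k | ∃ D : Set V, G.IsDominatingSet D ∧ D.ncard = k}.Nonempty :=
    ⟨_, Set.univ, fun v => ⟨v, trivial, Or.inl rfl⟩, rfl⟩
  obtain ⟨D, hD, hcard⟩ := Nat.sInf_mem hne
  lift D to Finset V using D.toFinite
  rw [Set.ncard_coe_finset] at hcard
  have hsel : A.selected P ident r =
      {v | NodeMap.dominating (2 * b) s (2 ^ m * (8 * (d + 1))) m V G P ident v = true} := by
    ext v
    rw [LocalAlgorithm.selected, Set.mem_ofPred_eq, hA, Set.mem_ofPred_eq]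
  obtain ⟨hdom, hle⟩ := NodeMap.dominating_spec hd hb hb0 hs hfree
    (Nat.lt_two_pow_self (n := m)).le P hid hD
  rw [hsel]
  refine ⟨hdom, hle.trans ?_⟩
  rw [SimpleGraph.dominationNumber, ← hcard]
  exact Nat.mul_le_mul_right _ (le_approxFactor hb0 hs)

open scoped Classical in
-- K_{d+1,t} has density above d exactly when t > d(d + 1), so the value used is the least possible.
theorem SimpleGraph.free_completeBipartiteGraph_of_nabla0_le {V : Type*} [Finite V]
    {G : SimpleGraph V} {d : ℕ} (hd : G.nabla0 ≤ d) :
    (completeBipartiteGraph (Fin (d + 1)) (Fin (d * (d + 1) + 1))).Free G := by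
  rintro ⟨φ⟩
  have := Fintype.ofFinite V
  let X : Finset V := Finset.univ.image fun i => φ (Sum.inl i)
  let B : Finset V := Finset.univ.image fun i => φ (Sum.inr i)
  have hX : X.card = d + 1 := by
    exact (Finset.card_image_of_injective _ fun i j h =>
      Sum.inl_injective (φ.injective h)).trans (by simp)
  have hB : B.card = d * (d + 1) + 1 := by
    exact (Finset.card_image_of_injective _ fun i j h =>
      Sum.inr_injective (φ.injective h)).trans (by simp)
  have hadj : ∀ x ∈ X, ∀ w ∈ B, G.Adj x w := by
    intro x hx w hw
    obtain ⟨i, -, rfl⟩ := Finset.mem_image.mp hx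
    obtain ⟨j, -, rfl⟩ := Finset.mem_image.mp hw
    exact φ.toHom.map_adj (by simp)
  have hdisj : Disjoint X B := Finset.disjoint_left.mpr fun x hx hB => (hadj x hx x hB).ne rfl
  have h := sum_card_adj_le_of_nabla0_le hd (X ∪ B)
  rw [Finset.sum_union hdisj, Finset.card_union_of_disjoint hdisj] at h
  have h1 : X.card * B.card ≤ ∑ u ∈ X, {w ∈ X ∪ B | G.Adj u w}.card :=
    Finset.card_nsmul_le_sum _ _ _ fun x hx => Finset.card_le_card fun w hw =>
      Finset.mem_filter.mpr ⟨Finset.mem_union_right _ hw, hadj x hx w hw⟩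
  have h2 : B.card * X.card ≤ ∑ u ∈ B, {w ∈ X ∪ B | G.Adj u w}.card :=
    Finset.card_nsmul_le_sum _ _ _ fun x hx => Finset.card_le_card fun w hw =>
      Finset.mem_filter.mpr ⟨Finset.mem_union_left _ hw, (hadj w hw x hx).symm⟩
  rw [hX, hB] at *
  nlinarith

theorem theorem1 (d : ℕ) (hd : 0 < d) :
    -- a constant-round algorithm with a constant approximation factor, given only `∇₁(G) ≤ d`
    (∃ (r : ℕ) (A : LocalAlgorithm Bool), ∀ (V : Type*) [Finite V] (G : SimpleGraph V),
      G.nabla1 ≤ d →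
        A.ApproximatesDominatingSet r
          ((2 * (d + 1)) ^ (2 * (2 * (d + 1)) ^ 2) + 2 * (d + 1)) G) ∧
    -- the factor in terms of the parameters; the number of rounds depends only on `d` and `t`
    (∀ t : ℕ, ∃ r : ℕ, ∀ d₀ b s : ℕ, d₀ ≤ d → b ≤ d + 1 → 1 ≤ s → s ≤ t →
      ∃ A : LocalAlgorithm Bool, ∀ (V : Type*) [Finite V] (G : SimpleGraph V),
        G.nabla1 ≤ d → G.nabla0 ≤ d₀ → G.nabla1B < b →
        (completeBipartiteGraph (Fin s) (Fin t)).Free G →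
          A.ApproximatesDominatingSet r (approxFactor d₀ b s) G) ∧
    -- the second factor is at most the first one, for parameters with `s ≤ 2d + 1`
    (∀ d₀ b s : ℕ, d₀ ≤ d → b ≤ d + 1 → s ≤ 2 * d + 1 →
      approxFactor d₀ b s ≤ (2 * (d + 1)) ^ (2 * (2 * (d + 1)) ^ 2) + 2 * (d + 1)) := by
  refine ⟨?_, fun t => ?_, fun d₀ b s hd₀ hb hs => approxFactor_le hd₀ hb hs⟩
  · obtain ⟨A, hA⟩ := exists_approximatesDominatingSet d (d + 1) (d + 1) (d * (d + 1) + 1)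
      (Nat.le_add_left 1 d) le_rfl
    refine ⟨roundBound (d + 1) (d + 1) (d * (d + 1) + 1), A, fun V _ G hG P ident hid => ?_⟩
    have hd₀ : G.nabla0 ≤ d := G.nabla0_le_nabla1.trans hG
    have hb : G.nabla1B < (d + 1 : ℕ) := (G.nabla1B_le_nabla1.trans hG).trans_lt (by simp)
    obtain ⟨hdom, hle⟩ :=
      hA V G hd₀ hb (SimpleGraph.free_completeBipartiteGraph_of_nabla0_le hd₀) P ident hid
    exact ⟨hdom, hle.trans (Nat.mul_le_mul_right _ (approxFactor_le le_rfl le_rfl (by omega)))⟩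
  -- The sum is merely a common upper bound for the finitely many pairs (b, s).
  · refine ⟨∑ p ∈ Finset.range (d + 2) ×ˢ Finset.range (t + 1), roundBound p.1 p.2 t,
      fun d₀ b s _ hb hs hst => ?_⟩
    have hmem : (b, s) ∈ Finset.range (d + 2) ×ˢ Finset.range (t + 1) := by
      simp only [Finset.mem_product, Finset.mem_range]
      omega
    obtain ⟨A, hA⟩ := exists_approximatesDominatingSet d₀ b s t hs
      (Finset.single_le_sum (f := fun p : ℕ × ℕ => roundBound p.1 p.2 t)
        (fun _ _ => Nat.zero_le _) hmem)
    exact ⟨A, fun V _ G _ => hA V G⟩
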